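/- Consider the eigenvalue problem $-u''=\lambda u$ on $(-1,1)$, $u\in C^2[-1,1]$, $\lambda\in\mathbb R$, with the multi-point boundary conditions at $x=\pm1$ $$\alpha_0^\pm u(\pm 1)+\beta_0^\pm u'(\pm 1)=\sum_{i=1}^{m^\pm}\alpha_i^\pm u(\eta_i^\pm)+\sum_{i=1}^{m^\pm}\beta_i^\pm u'(\eta_i^\pm),$$ where $m^\pm\ge1$, all coefficients are real, $\eta_i^\pm\in[-1,1]$, $\eta_i^\pm\ne\pm1$, and $$\alpha_0^\pm\ge0,\qquad \alpha_0^\pm+|\beta_0^\pm|>0,\qquad \pm\beta_0^\pm\ge0 .$$ Suppose that, at both ends, $$\frac{\sum_{i}|\alpha_i^\pm|}{\alpha_0^\pm}+\frac{\sum_{i}|\beta_i^\pm|}{|\beta_0^\pm|}<1,$$ with the convention that if a denominator is zero then the corresponding numerator must also be zero and the fraction is omitted. Let $J^\pm:=(\alpha_0^\pm/\beta_0^\pm)^2$ (with $J^\pm:=\infty$ if $\beta_0^\pm=0$), and suppose that $J^+<J^-$. The set of eigenvalues of this problem is the range of a strictly increasing sequence $\lambda_0<\lambda_1<\cdots$;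 let $\psi_k$ be any eigenfunction for $\lambda_k$. Let $\lambda_0^M<\lambda_1^M<\cdots$ be the eigenvalues of $-u''=\lambda u$ with the mixed conditions $u'(-1)=0$, $u(1)=0$, put $\lambda_{-1}^M:=0$, and let $$k_{T,M}:=\max\{k\ge-1:\lambda_k^M\le \min\{J^-,J^+\}\},\qquad k_{S,M}:=\min\{k\ge0:\lambda_k^M\ge \max\{J^-,J^+\}\}$$ (with $k_{S,M}:=\infty$ if there is no such $k$). For $k\ge-1$ let $R_k^+$ be the set of $u\in C^2[-1,1]$ that satisfy the multi-point boundary conditions and for which $u'(-1)>0$; $u(1)>0$ iff $k$ is even and $u(1)<0$ iff $k$ is odd; and $u$ has only simple zeros in $(-1,1)$ and exactly $k$ or $k+1$ of them. Let $R_k:=R_k^+\cup(-R_k^+)$. Then, for every integer $k\ge0$ with $k_{T,M}+1\le k\le k_{S,M}-1$, $$\psi_k\in R_k\qquad\text{and}\qquad \lambda_{k-1}^M<\lambda_k<\lambda_{k+1}^M .$$ -/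

import Mathlib

noncomputable section

namespace MultiPoint

/-- The interval `[-1, 1]`. -/
def I : Set ℝ := Set.Icc (-1) 1

/-- The derivative `u'` on `[-1, 1]` (one-sided at the end points).  Functions on `[-1, 1]` are
represented by functions `ℝ → ℝ`, whose values outside `[-1, 1]` are never used. -/
def D (u : ℝ → ℝ) : ℝ → ℝ := derivWithin u I

/-- The coefficients of one multi-point boundary condition
`α₀ u(e) + β₀ u'(e) = ∑ αᵢ u(ηᵢ) + ∑ βᵢ u'(ηᵢ)` at an end point `e = ±1`. -/
structure BoundaryData where
  m : ℕ
  alpha0 : ℝ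
  beta0 : ℝ
  alpha : Fin m → ℝ
  beta : Fin m → ℝ
  eta : Fin m → ℝ

namespace BoundaryData

/-- The multi-point boundary condition at the end point `e`. -/
def Holds (B : BoundaryData) (e : ℝ) (u : ℝ → ℝ) : Prop :=
  B.alpha0 * u e + B.beta0 * D u e
    = ∑ i, B.alpha i * u (B.eta i) + ∑ i, B.beta i * D u (B.eta i)

/-- The standing conditions on the coefficients at the end point `e = ±1`: there is at least one
term, `ηᵢ ∈ [-1, 1]` with `ηᵢ ≠ e`, `α₀ ≥ 0`, `α₀ + |β₀| > 0` and `e β₀ ≥ 0`. -/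
structure Admissible (B : BoundaryData) (e : ℝ) : Prop where
  one_le_m : 1 ≤ B.m
  eta_mem : ∀ i, B.eta i ∈ I
  eta_ne : ∀ i, B.eta i ≠ e
  alpha0_nonneg : 0 ≤ B.alpha0
  alpha0_beta0_pos : 0 < B.alpha0 + |B.beta0|
  sign_beta0 : 0 ≤ e * B.beta0

/-- The strengthened smallness condition `(∑ |αᵢ|) / α₀ + (∑ |βᵢ|) / |β₀| < 1`; if a denominator is
zero, then the numerator must be zero too, and the fraction is omitted (it is `0` in Lean). -/
structure Strengthened (B : BoundaryData) : Prop where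
  alpha_zero : B.alpha0 = 0 → ∑ i, |B.alpha i| = 0
  beta_zero : B.beta0 = 0 → ∑ i, |B.beta i| = 0
  sum_lt_one : (∑ i, |B.alpha i|) / B.alpha0 + (∑ i, |B.beta i|) / |B.beta0| < 1

/-- `J = (α₀ / β₀)²`, with `J = ∞` if `β₀ = 0`. -/
def J (B : BoundaryData) : EReal :=
  if B.beta0 = 0 then ⊤ else (((B.alpha0 / B.beta0) ^ 2 : ℝ) : EReal)

end BoundaryData

/-- The pair of multi-point boundary conditions, `Bm` at `-1` and `Bp` at `1`. -/
def MultiPointBC (Bm Bp : BoundaryData) (u : ℝ → ℝ) : Prop :=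
  Bm.Holds (-1) u ∧ Bp.Holds 1 u

/-- The mixed single-point boundary conditions: Neumann at `-1` and Dirichlet at `1`. -/
def MixedBC (u : ℝ → ℝ) : Prop := D u (-1) = 0 ∧ u 1 = 0

/-- The space `X` of functions in `C²[-1, 1]` that satisfy the boundary conditions. -/
def X (BC : (ℝ → ℝ) → Prop) : Set (ℝ → ℝ) := {u | ContDiffOn ℝ 2 u I ∧ BC u}

/-- `u ∈ X` is a non-trivial solution of `-u'' = lam u` on `(-1, 1)`. -/
def IsEigenfunction (BC : (ℝ → ℝ) → Prop) (lam : ℝ) (u : ℝ → ℝ) : Prop :=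
  u ∈ X BC ∧ (∀ x ∈ Set.Ioo (-1 : ℝ) 1, -D (D u) x = lam * u x) ∧ ∃ x ∈ I, u x ≠ 0

/-- The set of real eigenvalues. -/
def spec (BC : (ℝ → ℝ) → Prop) : Set ℝ := {lam | ∃ u, IsEigenfunction BC lam u}

/-- `lam 0 < lam 1 < ⋯` is the increasing enumeration of the set `S`
(a set has at most one such enumeration). -/
def IsIncreasingEnumeration (S : Set ℝ) (lam : ℕ → ℝ) : Prop :=
  StrictMono lam ∧ Set.range lam = S

/-- The sequence `lam`, extended to negative indices by `0`. -/
def ext (lam : ℕ → ℝ) (k : ℤ) : ℝ := if 0 ≤ k then lam k.toNat else 0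

/-- The zeros of `u` in `(-1, 1)`. -/
def interiorZeros (u : ℝ → ℝ) : Set ℝ := {x ∈ Set.Ioo (-1 : ℝ) 1 | u x = 0}

/-- The nodal set `R_k^+` (for `k ≥ -1`). -/
def RPlus (BC : (ℝ → ℝ) → Prop) (k : ℤ) : Set (ℝ → ℝ) :=
  {u ∈ X BC | 0 < D u (-1) ∧ (0 < u 1 ↔ Even k) ∧ (u 1 < 0 ↔ Odd k) ∧
    (∀ x ∈ interiorZeros u, D u x ≠ 0) ∧ (interiorZeros u).Finite ∧
    (((interiorZeros u).ncard : ℤ) = k ∨ ((interiorZeros u).ncard : ℤ) = k + 1)}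

/-- The nodal set `R_k = R_k^+ ∪ R_k^-`, where `R_k^- = -R_k^+`. -/
def R (BC : (ℝ → ℝ) → Prop) (k : ℤ) : Set (ℝ → ℝ) :=
  RPlus BC k ∪ {u | -u ∈ RPlus BC k}

/-- `kT` is the largest index `k ≥ -1` with `λ_k^M ≤ Jmin`, where `λ_{-1}^M = 0`. -/
def IsKTM (lamM : ℕ → ℝ) (Jmin : EReal) (kT : ℤ) : Prop :=
  IsGreatest {k : ℤ | -1 ≤ k ∧ (ext lamM k : EReal) ≤ Jmin} kT

/-- The smallest index `k` with `λ_k^M ≥ Jmax`; it is `∞` if there is none, which is the case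
`Jmax = ∞`. -/
def kSM (lamM : ℕ → ℝ) (Jmax : EReal) : ℕ∞ :=
  sInf {n : ℕ∞ | ∃ k : ℕ, Jmax ≤ (lamM k : EReal) ∧ n = k}

end MultiPoint

end

namespace MultiPoint

open Filter Topology

/-! For `lam = s² > 0` every solution is `Im (c e^{isx})`, and the condition at `1` reads `Im (c
e^{is} V(s)) = 0` with `V` the `symbol`. The condition at `-1` takes the same form after `x ↦ -x`.
Hence `s²` is an eigenvalue exactly when the sum of the two phases `s + arg V^±(s)` is an integer
multiple of π, and the eigenfunctions are then the multiples of `sin (s x + φ)`, where `φ` is the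
phase at `-1`.

The smallness condition makes the local part of `V` dominate: `Re V > 0` when `β₀ s ≤ α₀`, and `Im V
> 0` when `α₀ ≤ β₀ s` (`β₀` reflected at `-1`). So `arg V` stays in `(-π/2, π)` and is a continuous
branch. Each phase is strictly increasing (`rotation_speed_pos`), the total phase starts in `[0,
π)`, and it is unbounded; a convexity argument excludes `lam ≤ 0`. Thus the eigenvalues are `σ k ^
2`, with total phase `(k + 1) π` at `σ k`.

For the mixed problem the phases are `s` and `s + π/2`, which gives `√λ_k^M = t = (2k+1)π/4`. If `J⁺
< t² < J⁻`, comparing `σ k` with `t` yields `0 < arg V⁺ < π` and `|arg V⁻| < π/2`. These two bounds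
give the nodal class and both eigenvalue inequalities. -/

/-! ### Plane geometry behind the monotonicity of the phase -/

/-- Minkowski's inequality for finitely many plane vectors. -/
lemma sq_sum_abs_add_sq_sum_abs_le {ι : Type*} [Fintype ι] (r q w : ι → ℝ)
    (hw : ∀ i, 0 ≤ w i) (h : ∀ i, r i ^ 2 + q i ^ 2 ≤ w i ^ 2) :
    (∑ i, |r i|) ^ 2 + (∑ i, |q i|) ^ 2 ≤ (∑ i, w i) ^ 2 := by
  have h1 : ‖∑ i, (⟨|r i|, |q i|⟩ : ℂ)‖ ≤ ∑ i, w i := by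
    refine (norm_sum_le _ _).trans (Finset.sum_le_sum fun i _ => ?_)
    refine abs_le_of_sq_le_sq' ?_ (hw i) |>.2
    rw [← Complex.normSq_eq_norm_sq, Complex.normSq_mk]
    nlinarith [h i, sq_abs (r i), sq_abs (q i)]
  have h2 := pow_le_pow_left₀ (norm_nonneg _) h1 2
  rw [← Complex.normSq_eq_norm_sq, Complex.normSq_apply, Complex.re_sum, Complex.im_sum] at h2
  simpa [sq] using h2

lemma abs_sum_mul_le {ι : Type*} [Fintype ι] (a c : ι → ℝ) (hc : ∀ i, |c i| ≤ 1) :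
    |∑ i, a i * c i| ≤ ∑ i, |a i| := by
  refine (Finset.abs_sum_le_sum_abs _ _).trans (Finset.sum_le_sum fun i _ => ?_)
  rw [abs_mul]
  exact mul_le_of_le_one_right (abs_nonneg _) (hc i)

/-- A unit vector whose rotation by `x + i y` has positive real part cannot have both coordinates
on the wrong side of the bounds `b` and `-a`. -/
lemma not_lt_and_lt_of_unit {x y a b C S : ℝ} (hx : 0 < x) (hy : 0 < y) (ha : 0 ≤ a) (hb : 0 ≤ b)
    (hab : a + b < 1) (hCS : C ^ 2 + S ^ 2 = 1) (hP : 0 < x * C - y * S)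
    (hR : |x * S + y * C| ≤ a * x + b * y) (hC : C < b) : S ≤ -a := by
  by_contra! hS
  obtain ⟨hR1, hR2⟩ := abs_le.1 hR
  rcases le_or_gt 0 C with hC0 | hC0
  · have hSa : a < S := by
      by_contra! h
      nlinarith
    have hS0 : 0 < S := by linarith
    -- `hR` gives `x (S - a) ≤ y (b - C)`. Multiplying by `S` and using `y S < x C` yields `S² + C²
    -- ≤ a S + b C`, although the left side is `1` and the right side is below `1`.
    have h1 : x * S * (S - a) ≤ y * S * (b - C) := by nlinarith
    have h2 : y * S * (b - C) ≤ x * C * (b - C) := by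
      apply mul_le_mul_of_nonneg_right <;> linarith
    have h3 : x * (1 - (a * S + b * C)) ≤ 0 := by nlinarith
    have h4 : a * S + b * C < 1 := by nlinarith
    nlinarith
  · have hS0 : S < 0 := by
      by_contra! h
      nlinarith [mul_nonneg hy.le h, mul_pos hx (neg_pos.2 hC0)]
    have hCb : b < -C := by
      by_contra! h
      nlinarith
    have h1 : y * (-S) * (-C - b) ≤ x * (-S) * (a + S) := by nlinarith
    have h2 : x * (-C) * (-C - b) ≤ y * (-S) * (-C - b) := by
      apply mul_le_mul_of_nonneg_right <;> linarith
    have h3 : x * (1 - (a * (-S) + b * (-C))) ≤ 0 := by nlinarith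
    have h4 : a * (-S) + b * (-C) < 1 := by nlinarith
    nlinarith

lemma weighted_lt_max {x y a b : ℝ} (hxy : 0 < x + y)
    (hab : a + b < 1) (ha : 0 ≤ a) (hb : 0 ≤ b) : a * x + b * y < max x y := by
  have hm : 0 < max x y := by
    rcases le_total x y with h | h <;> simp only [max_eq_right h, max_eq_left h] <;> linarith
  nlinarith [mul_le_mul_of_nonneg_left (le_max_left x y) ha,
    mul_le_mul_of_nonneg_left (le_max_right x y) hb]

/-- The quantity is `|V|` times the derivative of the phase. Here `C + iS` is the unit number `p`
that makes `V p` positive, and `C' i + i S' i` is the `i`-th exponential times `p`; `hR` and `hP`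
say `Im (V p) = 0` and `Re (V p) > 0`. The terms with `s`-independent coefficients `β` are
nonnegative, and the rest is positive because the `|η i|` are at most `1`. -/
lemma rotation_speed_pos {ι : Type*} [Fintype ι] (α β C' S' η : ι → ℝ)
    {α₀ β₀ s a b C S : ℝ} (hs : 0 < s) (hα₀ : 0 ≤ α₀) (hβ₀ : 0 ≤ β₀) (hpos : 0 < α₀ + β₀)
    (ha : 0 ≤ a) (hb : 0 ≤ b) (hab : a + b < 1)
    (hα : ∑ i, |α i| = a * α₀) (hβ : ∑ i, |β i| = b * β₀)
    (hCS : C ^ 2 + S ^ 2 = 1) (hCS' : ∀ i, C' i ^ 2 + S' i ^ 2 = 1) (hη : ∀ i, |η i| ≤ 1)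
    (hR : α₀ * S + β₀ * s * C = ∑ i, (α i * S' i + β i * s * C' i))
    (hP : 0 < α₀ * C - β₀ * s * S - ∑ i, (α i * C' i - β i * s * S' i)) :
    0 < (β₀ * C - ∑ i, β i * C' i) + (α₀ * C - β₀ * s * S)
      - ∑ i, η i * (α i * C' i - β i * s * S' i) := by
  have hC1 : ∀ i, |C' i| ≤ 1 := fun i => abs_le_one_iff_mul_self_le_one.2 (by
    nlinarith [hCS' i, sq_nonneg (S' i)])
  have hS1 : ∀ i, |S' i| ≤ 1 := fun i => abs_le_one_iff_mul_self_le_one.2 (by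
    nlinarith [hCS' i, sq_nonneg (C' i)])
  set q : ι → ℝ := fun i => α i * C' i - β i * s * S' i with hq
  set r : ι → ℝ := fun i => α i * S' i + β i * s * C' i with hr
  have hmink := sq_sum_abs_add_sq_sum_abs_le r q (fun i => |α i| + s * |β i|)
    (fun i => by positivity) (fun i => by
      have : r i ^ 2 + q i ^ 2 = α i ^ 2 + (s * β i) ^ 2 := by
        simp only [hq, hr]
        linear_combination (α i ^ 2 + (s * β i) ^ 2) * hCS' i
      rw [this, add_sq, mul_pow s |β i|, sq_abs, sq_abs, mul_pow]
      have : 0 ≤ 2 * |α i| * (s * |β i|) := by positivity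
      linarith)
  rw [Finset.sum_add_distrib, ← Finset.mul_sum, hα, hβ] at hmink
  have hRr : |α₀ * S + β₀ * s * C| ≤ ∑ i, |r i| := by
    rw [hR]; exact Finset.abs_sum_le_sum_abs _ _
  have hRsq : (α₀ * S + β₀ * s * C) ^ 2 ≤ (∑ i, |r i|) ^ 2 := by
    rw [← sq_abs]; exact pow_le_pow_left₀ (abs_nonneg _) hRr 2
  have hlt : (a * α₀ + s * (b * β₀)) ^ 2 < α₀ ^ 2 + (β₀ * s) ^ 2 := by
    have hy : 0 ≤ β₀ * s := by positivity
    have hxy : 0 < α₀ + β₀ * s := by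
      rcases hα₀.eq_or_lt with h | h
      · have : 0 < β₀ := by linarith
        positivity
      · positivity
    have h1 := weighted_lt_max hxy hab ha hb
    have h2 : 0 ≤ a * α₀ + b * (β₀ * s) := by positivity
    have h3 : max α₀ (β₀ * s) ^ 2 ≤ α₀ ^ 2 + (β₀ * s) ^ 2 := by
      rcases max_choice α₀ (β₀ * s) with h | h <;> rw [h] <;> nlinarith
    calc (a * α₀ + s * (b * β₀)) ^ 2 = (a * α₀ + b * (β₀ * s)) ^ 2 := by ring
      _ < max α₀ (β₀ * s) ^ 2 := pow_lt_pow_left₀ h1 h2 two_ne_zero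
      _ ≤ _ := h3
  have hQ0 : 0 ≤ ∑ i, |q i| := Finset.sum_nonneg fun i _ => abs_nonneg _
  have hqle : -∑ i, |q i| ≤ ∑ i, q i := (abs_le.1 (Finset.abs_sum_le_sum_abs q _)).1
  -- The local vector has squared length `α₀² + (β₀ s)²`, which exceeds the Minkowski bound for the
  -- nonlocal part. By `hR` its imaginary part is no larger than `∑ |r i|`, so its real part must
  -- win; `hP` excludes the negative sign.
  have hPQ : ∑ i, |q i| < α₀ * C - β₀ * s * S := by
    have h1 : (∑ i, |q i|) ^ 2 < (α₀ * C - β₀ * s * S) ^ 2 := by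
      have : (α₀ * C - β₀ * s * S) ^ 2 + (α₀ * S + β₀ * s * C) ^ 2 = α₀ ^ 2 + (β₀ * s) ^ 2 := by
        linear_combination (α₀ ^ 2 + (β₀ * s) ^ 2) * hCS
      linarith
    by_contra! h
    nlinarith
  have hηq : ∑ i, η i * q i ≤ ∑ i, |q i| := by
    refine (le_abs_self _).trans ?_
    simpa only [mul_comm] using abs_sum_mul_le q η hη
  -- If this failed, `C < b`, and the boundary relation would give `S > -a`, which
  -- `not_lt_and_lt_of_unit` forbids.
  have hT : 0 ≤ β₀ * C - ∑ i, β i * C' i := by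
    by_contra! hT
    have h1 := abs_le.1 (abs_sum_mul_le β C' hC1)
    have h2 := abs_le.1 (abs_sum_mul_le α S' hS1)
    have h3 : ∑ i, r i = ∑ i, α i * S' i + s * ∑ i, β i * C' i := by
      rw [Finset.mul_sum, ← Finset.sum_add_distrib]
      exact Finset.sum_congr rfl fun i _ => by simp only [hr]; ring
    have h4 : α₀ * S + β₀ * s * C = ∑ i, α i * S' i + s * ∑ i, β i * C' i := hR.trans h3
    rw [hβ] at h1
    rw [hα] at h2
    have hC : C < b := by
      by_contra! h
      nlinarith [mul_le_mul_of_nonneg_left h hβ₀]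
    have hS : -a < S := by
      by_contra! h
      nlinarith [mul_le_mul_of_nonneg_left h hα₀, mul_pos hs (neg_pos.2 hT)]
    have hβ₁ : 0 < β₀ := by
      refine hβ₀.lt_of_ne fun h => ?_
      subst h
      linarith [h1.2]
    have hα₁ : 0 < α₀ := by
      refine hα₀.lt_of_ne fun h => ?_
      subst h
      nlinarith [h2.1, mul_pos hs (neg_pos.2 hT)]
    refine absurd hS (not_lt.2 (not_lt_and_lt_of_unit hα₁ (mul_pos hβ₁ hs) ha hb hab hCS
      (hQ0.trans_lt hPQ) ?_ hC))
    rw [h4, abs_le]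
    have h5 := mul_le_mul_of_nonneg_left h1.1 hs.le
    have h6 := mul_le_mul_of_nonneg_left h1.2 hs.le
    constructor <;> linarith [h2.1, h2.2]
  change 0 < _ - ∑ i, η i * q i
  linarith

/-! ### The symbol of a boundary condition and its phase -/

namespace BoundaryData

/-- The conditions on the coefficients at the end point `1`, without those on the number and the
distinctness of the interior points. -/
structure Regular (B : BoundaryData) : Prop where
  alpha0_nonneg : 0 ≤ B.alpha0
  beta0_nonneg : 0 ≤ B.beta0
  pos : 0 < B.alpha0 + B.beta0
  abs_eta_le : ∀ i, |B.eta i| ≤ 1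
  strengthened : B.Strengthened

lemma Regular.exists_weights {B : BoundaryData} (h : B.Regular) :
    ∃ a b : ℝ, 0 ≤ a ∧ 0 ≤ b ∧ a + b < 1 ∧ ∑ i, |B.alpha i| = a * B.alpha0 ∧
      ∑ i, |B.beta i| = b * B.beta0 := by
  have h1 : 0 ≤ ∑ i, |B.alpha i| := Finset.sum_nonneg fun i _ => abs_nonneg _
  have h2 : 0 ≤ ∑ i, |B.beta i| := Finset.sum_nonneg fun i _ => abs_nonneg _
  have h3 := h.strengthened.sum_lt_one
  rw [abs_of_nonneg h.beta0_nonneg] at h3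
  refine ⟨_, _, div_nonneg h1 h.alpha0_nonneg, div_nonneg h2 h.beta0_nonneg, h3, ?_, ?_⟩
  · by_cases h0 : B.alpha0 = 0
    · rw [h0, mul_zero, h.strengthened.alpha_zero h0]
    · exact (div_mul_cancel₀ _ h0).symm
  · by_cases h0 : B.beta0 = 0
    · rw [h0, mul_zero, h.strengthened.beta_zero h0]
    · exact (div_mul_cancel₀ _ h0).symm

/-- The function `u(x) = Im (c e^{isx})` satisfies the boundary condition at `1` if and only if
`Im (c e^{is} V(s)) = 0`, where `V` is the symbol. -/
noncomputable def symbol (B : BoundaryData) (s : ℝ) : ℂ :=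
  (B.alpha0 + B.beta0 * s * Complex.I) -
    ∑ i, (B.alpha i + B.beta i * s * Complex.I) * Complex.exp (-(s * (1 - B.eta i)) * Complex.I)

/-- The argument of `e^{is} V(s)`, lifted to a continuous function. -/
noncomputable def phase (B : BoundaryData) (s : ℝ) : ℝ := s + (B.symbol s).arg

lemma norm_nonlocal_le (B : BoundaryData) {s : ℝ} (hs : 0 ≤ s) :
    ‖∑ i, (B.alpha i + B.beta i * s * Complex.I) *
      Complex.exp (-(s * (1 - B.eta i)) * Complex.I)‖ ≤
      ∑ i, |B.alpha i| + s * ∑ i, |B.beta i| := by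
  rw [Finset.mul_sum, ← Finset.sum_add_distrib]
  refine (norm_sum_le _ _).trans (Finset.sum_le_sum fun i _ => ?_)
  have : ‖Complex.exp (-(s * (1 - B.eta i)) * Complex.I)‖ = 1 := by
    exact_mod_cast Complex.norm_exp_ofReal_mul_I (-(s * (1 - B.eta i)))
  rw [norm_mul, this, mul_one]
  refine (norm_add_le _ _).trans_eq ?_
  simp [abs_of_nonneg hs, mul_comm]

lemma Regular.nonlocal_lt {B : BoundaryData} (h : B.Regular) {s : ℝ} (hs : 0 < s) :
    ∑ i, |B.alpha i| + s * ∑ i, |B.beta i| < max B.alpha0 (B.beta0 * s) := by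
  obtain ⟨a, b, ha, hb, hab, hα, hβ⟩ := h.exists_weights
  have hxy : 0 < B.alpha0 + B.beta0 * s := by
    have h1 := h.pos
    have h2 := mul_nonneg h.beta0_nonneg hs.le
    rcases h.alpha0_nonneg.eq_or_lt with h0 | h0
    · have : 0 < B.beta0 := by linarith
      rw [← h0]; positivity
    · positivity
  rw [hα, hβ]
  calc _ = a * B.alpha0 + b * (B.beta0 * s) := by ring
    _ < _ := weighted_lt_max hxy hab ha hb

lemma Regular.symbol_re_pos {B : BoundaryData} (h : B.Regular) {s : ℝ} (hs : 0 < s)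
    (hle : B.beta0 * s ≤ B.alpha0) : 0 < (B.symbol s).re := by
  have h1 := h.nonlocal_lt hs
  rw [max_eq_left hle] at h1
  have h2 := ((Complex.re_le_norm _).trans (B.norm_nonlocal_le hs.le)).trans_lt h1
  rw [symbol, Complex.sub_re]
  simpa using h2

lemma Regular.symbol_im_pos {B : BoundaryData} (h : B.Regular) {s : ℝ} (hs : 0 < s)
    (hle : B.alpha0 ≤ B.beta0 * s) : 0 < (B.symbol s).im := by
  have h1 := h.nonlocal_lt hs
  rw [max_eq_right hle] at h1
  have h2 := ((Complex.im_le_norm _).trans (B.norm_nonlocal_le hs.le)).trans_lt h1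
  rw [symbol, Complex.sub_im]
  simpa using h2

lemma Regular.symbol_mem_slitPlane {B : BoundaryData} (h : B.Regular) {s : ℝ} (hs : 0 < s) :
    B.symbol s ∈ Complex.slitPlane := by
  rcases le_total (B.beta0 * s) B.alpha0 with h1 | h1
  · exact Or.inl (h.symbol_re_pos hs h1)
  · exact Or.inr (h.symbol_im_pos hs h1).ne'

lemma Regular.arg_lt_pi_div_two {B : BoundaryData} (h : B.Regular) {s : ℝ} (hs : 0 < s)
    (hle : B.beta0 * s ≤ B.alpha0) : (B.symbol s).arg < Real.pi / 2 :=
  (abs_lt.1 (Complex.abs_arg_lt_pi_div_two_iff.2 (Or.inl (h.symbol_re_pos hs hle)))).2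

lemma Regular.arg_pos {B : BoundaryData} (h : B.Regular) {s : ℝ} (hs : 0 < s)
    (hle : B.alpha0 ≤ B.beta0 * s) : 0 < (B.symbol s).arg := by
  have h1 := h.symbol_im_pos hs hle
  refine (Complex.arg_nonneg_iff.2 h1.le).lt_of_ne fun h0 => ?_
  exact h1.ne' (Complex.arg_eq_zero_iff.1 h0.symm).2

lemma Regular.arg_lt_pi {B : BoundaryData} (h : B.Regular) {s : ℝ} (hs : 0 < s) :
    (B.symbol s).arg < Real.pi :=
  (Complex.arg_le_pi _).lt_of_ne (Complex.mem_slitPlane_iff_arg.1 (h.symbol_mem_slitPlane hs)).1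

lemma Regular.neg_pi_div_two_lt_arg {B : BoundaryData} (h : B.Regular) {s : ℝ} (hs : 0 < s) :
    -(Real.pi / 2) < (B.symbol s).arg := by
  rcases le_total (B.beta0 * s) B.alpha0 with h1 | h1
  · exact (abs_lt.1 (Complex.abs_arg_lt_pi_div_two_iff.2 (Or.inl (h.symbol_re_pos hs h1)))).1
  · linarith [h.arg_pos hs h1, Real.pi_pos]

lemma hasDerivAt_symbol (B : BoundaryData) (s : ℝ) :
    HasDerivAt B.symbol (B.beta0 * Complex.I -
      ∑ i, (B.beta i * Complex.I * Complex.exp (-(s * (1 - B.eta i)) * Complex.I) +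
        (B.alpha i + B.beta i * s * Complex.I) *
          (Complex.exp (-(s * (1 - B.eta i)) * Complex.I) * (-(1 - B.eta i) * Complex.I)))) s := by
  have h0 : ∀ c : ℂ, HasDerivAt (fun s : ℝ => c * (s : ℂ)) c s := fun c => by
    simpa using (Complex.ofRealCLM.hasDerivAt (x := s)).const_mul c
  have h1 : ∀ c d : ℂ, HasDerivAt (fun s : ℝ => d + c * s * Complex.I) (c * Complex.I) s :=
    fun c d => ((h0 c).mul_const _).const_add d
  refine (h1 _ _).sub (HasDerivAt.fun_sum fun i _ => (h1 _ _).mul ?_)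
  refine HasDerivAt.cexp ?_
  have := (h0 (1 - B.eta i)).neg.mul_const Complex.I
  refine this.congr_of_eventuallyEq (Eventually.of_forall fun s => ?_)
  simp [mul_comm]

lemma Regular.exists_hasDerivAt_phase_pos {B : BoundaryData} (h : B.Regular) {s : ℝ}
    (hs : 0 < s) : ∃ g', HasDerivAt B.phase g' s ∧ 0 < g' := by
  have hV := h.symbol_mem_slitPlane hs
  have hd := B.hasDerivAt_symbol s
  set V' := (B.beta0 * Complex.I -
      ∑ i, (B.beta i * Complex.I * Complex.exp (-(s * (1 - B.eta i)) * Complex.I) +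
        (B.alpha i + B.beta i * s * Complex.I) *
          (Complex.exp (-(s * (1 - B.eta i)) * Complex.I) * (-(1 - B.eta i) * Complex.I))) : ℂ)
    with hV'
  have h1 := hd.clog_real hV
  have h2 : HasDerivAt (fun s => (Complex.log (B.symbol s)).im) (V' / B.symbol s).im s := by
    have := Complex.imCLM.hasFDerivAt.comp_hasDerivAt s h1
    exact this
  simp only [Complex.log_im] at h2
  refine ⟨_, (hasDerivAt_id s).add h2, ?_⟩
  have hne : B.symbol s ≠ 0 := Complex.slitPlane_ne_zero hV
  -- The derivative is `1 + Im (V'/V)`. With `p = |V|/V` it becomes `(|V| + Im (V' p))/|V|`, whose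
  -- numerator `rotation_speed_pos` controls.
  have hn : 0 < ‖B.symbol s‖ := norm_pos_iff.2 hne
  obtain ⟨p, hp, hpV⟩ : ∃ p : ℂ, ‖p‖ = 1 ∧ B.symbol s * p = ‖B.symbol s‖ := by
    refine ⟨‖B.symbol s‖ / B.symbol s, ?_, ?_⟩
    · simp [hn.ne']
    · field_simp
  have hinv : V' / B.symbol s = V' * p / ‖B.symbol s‖ := by
    rw [← hpV]
    have : p ≠ 0 := by
      rintro rfl
      simp at hp
    field_simp
  rw [hinv, Complex.div_ofReal_im]
  suffices hsuff : 0 < ‖B.symbol s‖ + (V' * p).im by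
    have : (1 : ℝ) + (V' * p).im / ‖B.symbol s‖ = (‖B.symbol s‖ + (V' * p).im) / ‖B.symbol s‖ := by
      field_simp
    rw [this]
    positivity
  obtain ⟨a, b, ha, hb, hab, hα, hβ⟩ := h.exists_weights
  have hsq : ∀ z : ℂ, ‖z‖ = 1 → z.re ^ 2 + z.im ^ 2 = 1 := fun z hz => by
    have := Complex.sq_norm z
    rw [hz, Complex.normSq_apply] at this
    linarith
  set q : Fin B.m → ℂ := fun i => Complex.exp (-(s * (1 - B.eta i)) * Complex.I) * p with hq
  have hqn : ∀ i, ‖q i‖ = 1 := fun i => by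
    have : ‖Complex.exp (-(s * (1 - B.eta i)) * Complex.I)‖ = 1 := by
      exact_mod_cast Complex.norm_exp_ofReal_mul_I (-(s * (1 - B.eta i)))
    rw [hq, norm_mul, this, hp, one_mul]
  have e1 : B.symbol s * p = (B.alpha0 + B.beta0 * s * Complex.I) * p -
      ∑ i, (B.alpha i + B.beta i * s * Complex.I) * q i := by
    rw [symbol, sub_mul, Finset.sum_mul]
    simp only [hq, mul_assoc]
  have e2 : V' * p = B.beta0 * Complex.I * p - ∑ i, (B.beta i * Complex.I * q i -
      (1 - B.eta i) * Complex.I * ((B.alpha i + B.beta i * s * Complex.I) * q i)) := by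
    rw [hV', sub_mul, Finset.sum_mul]
    congr 1
    refine Finset.sum_congr rfl fun i _ => ?_
    simp only [hq]
    ring
  rw [hpV] at e1
  generalize V' * p = w at e2 ⊢
  have hre := congrArg Complex.re e1
  have him := congrArg Complex.im e1
  have him2 := congrArg Complex.im e2
  simp only [Complex.ofReal_re, Complex.ofReal_im, Complex.sub_re, Complex.sub_im, Complex.mul_re,
    Complex.mul_im, Complex.add_re, Complex.add_im, Complex.I_re, Complex.I_im, Complex.re_sum,
    Complex.im_sum, Complex.one_re, Complex.one_im, mul_zero, mul_one, sub_zero, add_zero,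
    zero_add, zero_mul, sub_self] at hre him him2
  have key := rotation_speed_pos B.alpha B.beta (fun i => (q i).re) (fun i => (q i).im) B.eta hs
    h.alpha0_nonneg h.beta0_nonneg h.pos ha hb hab hα hβ (hsq p hp) (fun i => hsq _ (hqn i))
    h.abs_eta_le (by linarith) (by linarith)
  rw [him2, hre]
  refine key.trans_eq ?_
  simp only [Finset.sum_sub_distrib, sub_mul, one_mul, mul_sub]
  ring

lemma Regular.strictMonoOn_phase {B : BoundaryData} (h : B.Regular) :
    StrictMonoOn B.phase (Set.Ioi 0) := by
  refine strictMonoOn_of_deriv_pos (convex_Ioi 0) (fun s hs => ?_) fun s hs => ?_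
  · obtain ⟨g', hg, -⟩ := h.exists_hasDerivAt_phase_pos hs
    exact hg.continuousAt.continuousWithinAt
  · rw [interior_Ioi] at hs
    obtain ⟨g', hg, hpos⟩ := h.exists_hasDerivAt_phase_pos hs
    rwa [hg.deriv]

lemma Regular.continuousOn_phase {B : BoundaryData} (h : B.Regular) :
    ContinuousOn B.phase (Set.Ioi 0) := fun s hs => by
  obtain ⟨g', hg, -⟩ := h.exists_hasDerivAt_phase_pos hs
  exact hg.continuousAt.continuousWithinAt

lemma Regular.tendsto_phase_of_pos {B : BoundaryData} (h : B.Regular) (h0 : 0 < B.alpha0) :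
    Tendsto B.phase (𝓝[>] 0) (𝓝 0) := by
  obtain ⟨a, b, ha, hb, hab, hα, hβ⟩ := h.exists_weights
  have h1 : B.symbol 0 = ((B.alpha0 - ∑ i, B.alpha i : ℝ) : ℂ) := by
    simp [symbol]
  have h2 : 0 < B.alpha0 - ∑ i, B.alpha i := by
    have : ∑ i, B.alpha i ≤ ∑ i, |B.alpha i| := Finset.sum_le_sum fun i _ => le_abs_self _
    nlinarith
  have h3 : ContinuousAt B.phase 0 := by
    refine continuousAt_id.add ((Complex.continuousAt_arg ?_).comp
      (B.hasDerivAt_symbol 0).continuousAt)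
    rw [h1]
    exact Complex.ofReal_mem_slitPlane.2 h2
  have h4 : B.phase 0 = 0 := by
    rw [phase, h1, Complex.arg_ofReal_of_nonneg h2.le, zero_add]
  have h5 := h3.tendsto
  rw [h4] at h5
  exact h5.mono_left nhdsWithin_le_nhds

/-- Here all `αᵢ` vanish and `V(0) = 0`, where `arg` is not continuous. The positive factor `s` is
divided out without changing the argument, leaving `U` with `U 0` a positive multiple of `i`. -/
lemma Regular.tendsto_phase_of_eq_zero {B : BoundaryData} (h : B.Regular) (h0 : B.alpha0 = 0) :
    Tendsto B.phase (𝓝[>] 0) (𝓝 (Real.pi / 2)) := by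
  obtain ⟨a, b, ha, hb, hab, hα, hβ⟩ := h.exists_weights
  have hβ0 : 0 < B.beta0 := by have := h.pos; rwa [h0, zero_add] at this
  have hα0 : ∀ i, B.alpha i = 0 := fun i => by
    rw [h0, mul_zero, Finset.sum_eq_zero_iff_of_nonneg fun i _ => abs_nonneg _] at hα
    exact abs_eq_zero.1 (hα i (Finset.mem_univ i))
  set U : ℝ → ℂ := fun s => (B.beta0 -
    ∑ i, B.beta i * Complex.exp (-(s * (1 - B.eta i)) * Complex.I)) * Complex.I with hU
  have hVU : ∀ s, B.symbol s = s * U s := fun s => by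
    simp only [symbol, hα0, h0, hU, sub_mul, mul_sub, Finset.sum_mul, Finset.mul_sum]
    congr 1
    · simp; ring
    · exact Finset.sum_congr rfl fun i _ => by simp; ring
  have h1 : U 0 = ((B.beta0 - ∑ i, B.beta i : ℝ) : ℂ) * Complex.I := by
    simp [hU]
  have h2 : 0 < B.beta0 - ∑ i, B.beta i := by
    have : ∑ i, B.beta i ≤ ∑ i, |B.beta i| := Finset.sum_le_sum fun i _ => le_abs_self _
    nlinarith
  have h3 : ContinuousAt (fun s => s + (U s).arg) 0 := by
    refine continuousAt_id.add (ContinuousAt.comp (f := U) (Complex.continuousAt_arg ?_) ?_)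
    · rw [h1]
      exact Or.inr (by simpa using h2.ne')
    · exact Continuous.continuousAt (by fun_prop)
  have h4 : (0 : ℝ) + (U 0).arg = Real.pi / 2 := by
    rw [h1, Complex.arg_real_mul _ h2, Complex.arg_I, zero_add]
  have h5 := h3.tendsto
  rw [h4] at h5
  refine (h5.mono_left nhdsWithin_le_nhds).congr' ?_
  filter_upwards [self_mem_nhdsWithin] with s hs
  rw [phase, hVU, Complex.arg_real_mul _ hs]

/-! ### Reflection of the left end point -/

/-- The boundary condition at `-1`, transported to `1` by `x ↦ -x`. -/
def reflect (B : BoundaryData) : BoundaryData where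
  m := B.m
  alpha0 := B.alpha0
  beta0 := -B.beta0
  alpha := B.alpha
  beta i := -B.beta i
  eta i := -B.eta i

/-- The boundary condition for a function `u` with derivative `v`. -/
def HoldsFor (B : BoundaryData) (e : ℝ) (u v : ℝ → ℝ) : Prop :=
  B.alpha0 * u e + B.beta0 * v e = ∑ i, B.alpha i * u (B.eta i) + ∑ i, B.beta i * v (B.eta i)

lemma holdsFor_reflect (B : BoundaryData) (e : ℝ) (u v : ℝ → ℝ) :
    B.reflect.HoldsFor e (fun x => u (-x)) (fun x => -v (-x)) ↔ B.HoldsFor (-e) u v := by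
  simp only [HoldsFor, reflect, neg_mul_neg, neg_neg]
  exact Iff.rfl

lemma Admissible.regular {B : BoundaryData} (h : B.Admissible 1) (hs : B.Strengthened) :
    B.Regular where
  alpha0_nonneg := h.alpha0_nonneg
  beta0_nonneg := by simpa using h.sign_beta0
  pos := by
    have h1 : 0 ≤ B.beta0 := by simpa using h.sign_beta0
    simpa [abs_of_nonneg h1] using h.alpha0_beta0_pos
  abs_eta_le i := abs_le.2 (h.eta_mem i)
  strengthened := hs

lemma Admissible.regular_reflect {B : BoundaryData} (h : B.Admissible (-1))
    (hs : B.Strengthened) : B.reflect.Regular where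
  alpha0_nonneg := h.alpha0_nonneg
  beta0_nonneg := by simpa [reflect] using h.sign_beta0
  pos := by
    have h1 : B.beta0 ≤ 0 := by simpa using h.sign_beta0
    simpa [abs_of_nonpos h1, reflect] using h.alpha0_beta0_pos
  abs_eta_le i := by
    simpa [reflect] using abs_le.2 (h.eta_mem i)
  strengthened :=
    have h1 : ∑ i, |B.reflect.beta i| = ∑ i, |B.beta i| :=
      Finset.sum_congr rfl fun i _ => abs_neg _
    { alpha_zero := hs.alpha_zero
      beta_zero := fun h0 => h1.trans (hs.beta_zero (neg_eq_zero.1 h0))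
      sum_lt_one := by
        have h2 : |B.reflect.beta0| = |B.beta0| := abs_neg _
        rw [h1, h2]
        exact hs.sum_lt_one }

end BoundaryData

/-! ### Solutions of the equation; exclusion of `lam ≤ 0` -/

/-- `u` solves `-u'' = lam u` on the closed interval, with derivative `v`. -/
structure IsSolution (lam : ℝ) (u v : ℝ → ℝ) : Prop where
  hasDeriv : ∀ x ∈ I, HasDerivWithinAt u (v x) I x
  hasDeriv_deriv : ∀ x ∈ I, HasDerivWithinAt v (-lam * u x) I x

lemma uniqueDiffOn_I : UniqueDiffOn ℝ I := uniqueDiffOn_Icc (by norm_num)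

lemma isSolution_of_contDiffOn {lam : ℝ} {u : ℝ → ℝ} (hu : ContDiffOn ℝ 2 u I)
    (h : ∀ x ∈ Set.Ioo (-1 : ℝ) 1, -D (D u) x = lam * u x) : IsSolution lam u (D u) := by
  have hD : ContDiffOn ℝ 1 (D u) I := hu.derivWithin uniqueDiffOn_I (by norm_num)
  have hDD : ContinuousOn (D (D u)) I := hD.continuousOn_derivWithin uniqueDiffOn_I le_rfl
  have heq : Set.EqOn (D (D u)) (fun x => -lam * u x) I := by
    refine Set.EqOn.of_subset_closure (s := Set.Ioo (-1 : ℝ) 1) (fun x hx => ?_) hDD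
      (hu.continuousOn.const_smul (-lam)) Set.Ioo_subset_Icc_self ?_
    · have := h x hx
      change D (D u) x = -lam * u x
      linarith
    · rw [closure_Ioo (by norm_num)]; exact subset_rfl
  refine ⟨fun x hx => ((hu.differentiableOn (by norm_num)) x hx).hasDerivWithinAt, fun x hx => ?_⟩
  have h1 := ((hD.differentiableOn (by norm_num)) x hx).hasDerivWithinAt
  rwa [show derivWithin (D u) I x = -lam * u x from heq hx] at h1

lemma eq_of_hasDerivWithinAt_zero {E : Type*} [NormedAddCommGroup E] [NormedSpace ℝ E]
    {f : ℝ → E} (hf : ∀ x ∈ I, HasDerivWithinAt f 0 I x) {x : ℝ} (hx : x ∈ I) : f x = f (-1) :=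
  constant_of_derivWithin_zero (fun y hy => (hf y hy).differentiableWithinAt)
    (fun y hy => (hf y (Set.Ico_subset_Icc_self hy)).derivWithin
      (uniqueDiffOn_I y (Set.Ico_subset_Icc_self hy))) x hx

/-- Convexity puts the maximum at an end point, and a negative slope at `1` would make `g` strictly
decreasing. -/
lemma le_right_of_monotoneOn_deriv {g w : ℝ → ℝ} (hg : ∀ x ∈ I, HasDerivWithinAt g (w x) I x)
    (hw : MonotoneOn w I) (hle : g (-1) ≤ g 1) : (∀ x ∈ I, g x ≤ g 1) ∧ 0 ≤ w 1 := by
  have hmem : (1 : ℝ) ∈ I := ⟨by norm_num, le_rfl⟩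
  have hmem' : (-1 : ℝ) ∈ I := ⟨le_rfl, by norm_num⟩
  have hconv : Convex ℝ I := convex_Icc _ _
  have hcont : ContinuousOn g I := fun x hx => (hg x hx).continuousWithinAt
  have hderiv : ∀ x ∈ interior I, HasDerivAt g (w x) x := fun x hx =>
    (hg x (interior_subset hx)).hasDerivAt (mem_interior_iff_mem_nhds.1 hx)
  constructor
  · have hc : ConvexOn ℝ I g := by
      refine MonotoneOn.convexOn_of_deriv hconv hcont
        (fun x hx => (hderiv x hx).differentiableAt.differentiableWithinAt) fun x hx y hy hxy => ?_
      rw [(hderiv x hx).deriv, (hderiv y hy).deriv]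
      exact hw (interior_subset hx) (interior_subset hy) hxy
    intro x hx
    exact (hc.le_max_of_mem_Icc hmem' hmem hx).trans (max_le hle le_rfl)
  · by_contra! hneg
    have hanti : StrictAntiOn g I := strictAntiOn_of_deriv_neg hconv hcont fun x hx => by
      rw [(hderiv x hx).deriv]
      exact (hw (interior_subset hx) hmem (interior_subset hx).2).trans_lt hneg
    exact (hanti hmem' hmem (by norm_num)).not_ge hle

namespace IsSolution

variable {lam : ℝ} {u v : ℝ → ℝ}

lemma reflect (h : IsSolution lam u v) :
    IsSolution lam (fun x => u (-x)) (fun x => -v (-x)) := by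
  have hmem : ∀ x ∈ I, -x ∈ I := fun x hx => ⟨by linarith [hx.2], by linarith [hx.1]⟩
  constructor
  · intro x hx
    have := (h.hasDeriv (-x) (hmem x hx)).scomp x (hasDerivWithinAt_neg x I) hmem
    simpa [Function.comp_def] using this
  · intro x hx
    have := ((h.hasDeriv_deriv (-x) (hmem x hx)).scomp x (hasDerivWithinAt_neg x I) hmem).neg
    refine this.congr_deriv ?_
    simp

/-- For `lam ≤ 0` the product `u v` is nondecreasing, so `u²` and `v²` are convex. Constancy of `v²
+ lam u²` transfers the end-point comparison from `u²` to `v²`. -/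
lemma sq_le_of_nonpos (h : IsSolution lam u v) (hlam : lam ≤ 0) (hle : u (-1) ^ 2 ≤ u 1 ^ 2) :
    (∀ x ∈ I, u x ^ 2 ≤ u 1 ^ 2) ∧ (∀ x ∈ I, v x ^ 2 ≤ v 1 ^ 2) ∧ 0 ≤ u 1 * v 1 := by
  have hmem : (1 : ℝ) ∈ I := ⟨by norm_num, le_rfl⟩
  have hf : ∀ x ∈ I, HasDerivWithinAt (fun x => u x * v x) (v x ^ 2 + -lam * u x ^ 2) I x :=
    fun x hx => by
      refine ((h.hasDeriv x hx).mul (h.hasDeriv_deriv x hx)).congr_deriv ?_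
      ring
  have hu : ∀ x ∈ I, HasDerivWithinAt (fun x => u x ^ 2) (2 * (u x * v x)) I x :=
    fun x hx => by
      refine ((h.hasDeriv x hx).pow 2).congr_deriv ?_
      push_cast; ring
  have hv : ∀ x ∈ I, HasDerivWithinAt (fun x => v x ^ 2) (-lam * (2 * (u x * v x))) I x :=
    fun x hx => by
      refine ((h.hasDeriv_deriv x hx).pow 2).congr_deriv ?_
      push_cast; ring
  have hmono : MonotoneOn (fun x => u x * v x) I := by
    refine monotoneOn_of_hasDerivWithinAt_nonneg (convex_Icc _ _)
      (fun x hx => (hf x hx).continuousWithinAt)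
      (fun x hx => (hf x (interior_subset hx)).mono interior_subset) fun x _ => ?_
    nlinarith [sq_nonneg (v x), mul_nonneg (neg_nonneg.2 hlam) (sq_nonneg (u x))]
  have hmono2 : MonotoneOn (fun x => 2 * (u x * v x)) I := fun x hx y hy hxy => by
    have : u x * v x ≤ u y * v y := hmono hx hy hxy
    change 2 * (u x * v x) ≤ 2 * (u y * v y)
    linarith
  obtain ⟨hu1, hu2⟩ := le_right_of_monotoneOn_deriv hu hmono2 hle
  refine ⟨hu1, ?_, by linarith⟩
  have henergy : ∀ x ∈ I, HasDerivWithinAt (fun x => v x ^ 2 + lam * u x ^ 2) 0 I x :=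
    fun x hx => by
      refine ((hv x hx).add ((hu x hx).const_mul lam)).congr_deriv ?_
      ring
  have h1 := eq_of_hasDerivWithinAt_zero henergy hmem
  refine (le_right_of_monotoneOn_deriv hv (fun x hx y hy hxy => ?_) ?_).1
  · exact mul_le_mul_of_nonneg_left (hmono2 hx hy hxy) (neg_nonneg.2 hlam)
  · nlinarith

/-- Since `u` and `v` have compatible signs at `1`, nothing cancels on the local side, while the
nonlocal side is bounded by weights `a, b < 1`. So `α₀ u(1)` and `β₀ v(1)` both vanish. -/
lemma eq_zero_or_deriv_eq_zero (B : BoundaryData) (hB : B.Regular) (hbc : B.HoldsFor 1 u v)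
    (hu : ∀ x ∈ I, u x ^ 2 ≤ u 1 ^ 2) (hv : ∀ x ∈ I, v x ^ 2 ≤ v 1 ^ 2) (huv : 0 ≤ u 1 * v 1) :
    (∀ x ∈ I, u x = 0) ∨ (B.alpha0 = 0 ∧ ∀ x ∈ I, v x = 0) := by
  obtain ⟨a, b, ha, hb, hab, hα, hβ⟩ := hB.exists_weights
  have hη : ∀ i, B.eta i ∈ I := fun i => abs_le.1 (hB.abs_eta_le i)
  have hbound : ∀ (c : Fin B.m → ℝ) (w : ℝ → ℝ), (∀ x ∈ I, w x ^ 2 ≤ w 1 ^ 2) →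
      |∑ i, c i * w (B.eta i)| ≤ (∑ i, |c i|) * |w 1| := fun c w hw => by
    rw [Finset.sum_mul]
    refine (Finset.abs_sum_le_sum_abs _ _).trans (Finset.sum_le_sum fun i _ => ?_)
    rw [abs_mul]
    exact mul_le_mul_of_nonneg_left (sq_le_sq.1 (hw _ (hη i))) (abs_nonneg _)
  have h1 : B.alpha0 * |u 1| + B.beta0 * |v 1| ≤
      a * B.alpha0 * |u 1| + b * B.beta0 * |v 1| := by
    rw [← hα, ← hβ]
    calc _ = |B.alpha0 * u 1 + B.beta0 * v 1| := by
          rw [← abs_of_nonneg hB.alpha0_nonneg, ← abs_of_nonneg hB.beta0_nonneg, ← abs_mul,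
            ← abs_mul, abs_of_nonneg hB.alpha0_nonneg, abs_of_nonneg hB.beta0_nonneg]
          refine (abs_add_eq_add_abs_iff _ _).2 ?_ |>.symm
          have := hB.alpha0_nonneg
          have := hB.beta0_nonneg
          rcases mul_nonneg_iff.1 huv with ⟨h1, h2⟩ | ⟨h1, h2⟩
          · exact Or.inl ⟨by positivity, by positivity⟩
          · exact Or.inr ⟨mul_nonpos_of_nonneg_of_nonpos ‹_› h1,
              mul_nonpos_of_nonneg_of_nonpos ‹_› h2⟩
      _ ≤ _ := by
          rw [hbc]
          exact (abs_add_le _ _).trans (add_le_add (hbound _ _ hu) (hbound _ _ hv))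
  have h2 : 0 ≤ B.alpha0 * |u 1| := mul_nonneg hB.alpha0_nonneg (abs_nonneg _)
  have h3 : 0 ≤ B.beta0 * |v 1| := mul_nonneg hB.beta0_nonneg (abs_nonneg _)
  have h4 : B.alpha0 * |u 1| = 0 := by nlinarith
  have h5 : B.beta0 * |v 1| = 0 := by nlinarith
  have hz : ∀ w : ℝ → ℝ, (∀ x ∈ I, w x ^ 2 ≤ w 1 ^ 2) → |w 1| = 0 → ∀ x ∈ I, w x = 0 :=
    fun w hw h0 x hx => by
      have := hw x hx
      rw [abs_eq_zero.1 h0, zero_pow two_ne_zero] at this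
      exact pow_eq_zero_iff two_ne_zero |>.1 (this.antisymm (sq_nonneg _))
  rcases mul_eq_zero.1 h4 with h0 | h0
  · have : B.beta0 ≠ 0 := fun h => by
      have := hB.pos
      rw [h0, h] at this
      simp at this
    exact Or.inr ⟨h0, hz v hv ((mul_eq_zero.1 h5).resolve_left this)⟩
  · exact Or.inl (hz u hu h0)

lemma eq_zero_of_nonpos_of_sq_le {B B' : BoundaryData} (hB : B.Regular) (hB' : B'.Regular)
    (hα : 0 < B.alpha0 ∨ 0 < B'.alpha0) (h : IsSolution lam u v) (hlam : lam ≤ 0)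
    (hbc : B.HoldsFor 1 u v) (hbc' : B'.HoldsFor 1 (fun x => u (-x)) (fun x => -v (-x)))
    (hle : u (-1) ^ 2 ≤ u 1 ^ 2) : ∀ x ∈ I, u x = 0 := by
  obtain ⟨h1, h2, h3⟩ := h.sq_le_of_nonpos hlam hle
  refine (eq_zero_or_deriv_eq_zero B hB hbc h1 h2 h3).elim id fun ⟨h4, h5⟩ => ?_
  have hmem : ∀ x ∈ I, -x ∈ I := fun x hx => ⟨by linarith [hx.2], by linarith [hx.1]⟩
  -- Only a constant survives, and the condition at the other end kills it, because `α₀` is positive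
  -- there.
  have hconst : ∀ x ∈ I, u x = u (-1) := fun x hx =>
    eq_of_hasDerivWithinAt_zero (fun y hy => h5 y hy ▸ h.hasDeriv y hy) hx
  have h1' : (1 : ℝ) ∈ I := ⟨by norm_num, le_rfl⟩
  have key := eq_zero_or_deriv_eq_zero B' hB' hbc'
    (fun x hx => by rw [hconst _ (hmem x hx)])
    (fun x hx => by rw [h5 _ (hmem x hx), h5 _ (hmem 1 h1')])
    (by rw [h5 _ (hmem 1 h1')]; simp)
  rcases key with h6 | ⟨h6, -⟩
  · intro x hx
    simpa using h6 (-x) (hmem x hx)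
  · exact absurd hα (by simp [h4, h6])

lemma eq_zero_of_nonpos {B B' : BoundaryData} (hB : B.Regular) (hB' : B'.Regular)
    (hα : 0 < B.alpha0 ∨ 0 < B'.alpha0) (h : IsSolution lam u v) (hlam : lam ≤ 0)
    (hbc : B.HoldsFor 1 u v) (hbc' : B'.HoldsFor 1 (fun x => u (-x)) (fun x => -v (-x))) :
    ∀ x ∈ I, u x = 0 := by
  rcases le_total (u (-1) ^ 2) (u 1 ^ 2) with hle | hle
  · exact eq_zero_of_nonpos_of_sq_le hB hB' hα h hlam hbc hbc' hle
  · intro x hx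
    have := eq_zero_of_nonpos_of_sq_le hB' hB hα.symm h.reflect hlam hbc' (by simpa using hbc)
      (by simpa using hle) (-x) ⟨by linarith [hx.2], by linarith [hx.1]⟩
    simpa using this

/-- Solutions for `lam = s² > 0`: `u' / s + i u` is a multiple of `e^{isx}`. -/
lemma exists_eq_im_exp {s : ℝ} (hs : s ≠ 0) (h : IsSolution (s ^ 2) u v) :
    ∃ c : ℂ, ∀ x ∈ I, u x = (c * Complex.exp (s * x * Complex.I)).im ∧
      v x = s * (c * Complex.exp (s * x * Complex.I)).re := by
  have hs' : (s : ℂ) ≠ 0 := Complex.ofReal_ne_zero.2 hs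
  have hz : ∀ x ∈ I, HasDerivWithinAt (fun x : ℝ => (((v x : ℝ) : ℂ) / s + (u x : ℝ) * Complex.I) *
      Complex.exp (-(s * x * Complex.I))) 0 I x := fun x hx => by
    have h1 := (h.hasDeriv x hx).ofReal_comp
    have h2 := (h.hasDeriv_deriv x hx).ofReal_comp
    have h3 : HasDerivWithinAt (fun x : ℝ => -(s * (x : ℂ) * Complex.I)) (-(s * Complex.I)) I x := by
      have := (((Complex.ofRealCLM.hasDerivAt (x := x)).const_mul (s : ℂ)).mul_const
        Complex.I).neg.hasDerivWithinAt (s := I)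
      refine this.congr_deriv ?_
      simp
    refine (((h2.div_const (s : ℂ)).add (h1.mul_const Complex.I)).mul h3.cexp).congr_deriv ?_
    have e1 : ((-s ^ 2 * u x : ℝ) : ℂ) / s = -(s * u x) := by
      push_cast
      field_simp
    have e2 : (v x : ℂ) = s * (v x / s) := by field_simp
    rw [e1, Pi.add_apply]
    linear_combination (Complex.I * Complex.exp (-(s * x * Complex.I))) * e2 -
      (s * u x * Complex.exp (-(s * x * Complex.I))) * Complex.I_sq
  refine ⟨(((v (-1) : ℝ) : ℂ) / s + (u (-1) : ℝ) * Complex.I) *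
      Complex.exp (-(s * (-1 : ℝ) * Complex.I)), fun x hx => ?_⟩
  rw [← eq_of_hasDerivWithinAt_zero hz hx, mul_assoc, ← Complex.exp_add, neg_add_cancel,
    Complex.exp_zero, mul_one, ← Complex.ofReal_div]
  constructor
  · simp
  · simp
    field_simp

end IsSolution

/-! ### The spectrum through the total phase -/

namespace BoundaryData

lemma exp_mul_symbol (B : BoundaryData) (s : ℝ) :
    Complex.exp (s * Complex.I) * B.symbol s = ‖B.symbol s‖ * Complex.exp (B.phase s * Complex.I) := by
  conv_lhs => rw [← Complex.norm_mul_exp_arg_mul_I (B.symbol s)]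
  rw [phase, Complex.ofReal_add, add_mul, Complex.exp_add]
  ring

lemma Regular.holdsFor_iff {B : BoundaryData} (h : B.Regular) {s : ℝ} (hs : 0 < s) {c : ℂ}
    {u v : ℝ → ℝ} (hu : ∀ x ∈ I, u x = (c * Complex.exp (s * x * Complex.I)).im ∧
      v x = s * (c * Complex.exp (s * x * Complex.I)).re) :
    B.HoldsFor 1 u v ↔ (c * Complex.exp (B.phase s * Complex.I)).im = 0 := by
  have hn : 0 < ‖B.symbol s‖ :=
    norm_pos_iff.2 (Complex.slitPlane_ne_zero (h.symbol_mem_slitPlane hs))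
  have h1 : (c * Complex.exp (B.phase s * Complex.I)).im = 0 ↔
      (c * (Complex.exp (s * Complex.I) * B.symbol s)).im = 0 := by
    rw [exp_mul_symbol, mul_left_comm, Complex.im_ofReal_mul, mul_eq_zero, or_iff_right hn.ne']
  have h2 : c * (Complex.exp (s * Complex.I) * B.symbol s) =
      (B.alpha0 + B.beta0 * s * Complex.I) * (c * Complex.exp (s * (1 : ℝ) * Complex.I)) -
      ∑ i, (B.alpha i + B.beta i * s * Complex.I) *
        (c * Complex.exp (s * B.eta i * Complex.I)) := by
    rw [symbol, mul_sub, mul_sub, Finset.mul_sum, Finset.mul_sum]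
    congr 1
    · simp; ring
    · refine Finset.sum_congr rfl fun i _ => ?_
      have : Complex.exp (s * B.eta i * Complex.I) =
          Complex.exp (s * Complex.I) * Complex.exp (-(s * (1 - B.eta i)) * Complex.I) := by
        rw [← Complex.exp_add]
        ring_nf
      rw [this]
      ring
  have h3 : ∀ (a b x : ℝ), x ∈ I → ((a + b * s * Complex.I : ℂ) *
      (c * Complex.exp (s * x * Complex.I))).im = a * u x + b * v x := fun a b x hx => by
    obtain ⟨h1, h2⟩ := hu x hx
    rw [Complex.mul_im, ← h1]
    have : (a + b * s * Complex.I : ℂ).im = b * s := by simp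
    rw [this, mul_assoc b, ← h2]
    simp
  rw [h1, h2, Complex.sub_im, Complex.im_sum, h3 _ _ _ ⟨by norm_num, le_rfl⟩, sub_eq_zero,
    Finset.sum_congr rfl fun i _ => h3 _ _ _ (abs_le.1 (h.abs_eta_le i)),
    Finset.sum_add_distrib]
  rfl

lemma exists_seq_phase_eq {B B' : BoundaryData} (hB : B.Regular) (hB' : B'.Regular)
    (hα : 0 < B.alpha0 ∨ 0 < B'.alpha0) :
    ∃ σ : ℕ → ℝ, StrictMono σ ∧
      (∀ k, 0 < σ k ∧ B.phase (σ k) + B'.phase (σ k) = (k + 1) * Real.pi) ∧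
      ∀ t, 0 < t → ∀ n : ℤ, B.phase t + B'.phase t = n * Real.pi → ∃ k, t = σ k := by
  set G : ℝ → ℝ := fun s => B.phase s + B'.phase s with hG
  have hmono : StrictMonoOn G (Set.Ioi 0) := fun x hx y hy hxy =>
    add_lt_add (hB.strictMonoOn_phase hx hy hxy) (hB'.strictMonoOn_phase hx hy hxy)
  have hcont : ContinuousOn G (Set.Ioi 0) := hB.continuousOn_phase.add hB'.continuousOn_phase
  -- Each phase tends to `0` or `π/2`, and to `0` for at least one end by `hα`. The bound `l < π`
  -- makes the index start at `k = 0`.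
  obtain ⟨l, hl0, hl1, hl⟩ : ∃ l, 0 ≤ l ∧ l < Real.pi ∧ Tendsto G (𝓝[>] 0) (𝓝 l) := by
    have hpi := Real.pi_pos
    have aux : ∀ {B : BoundaryData}, B.Regular → ∃ l, 0 ≤ l ∧ l ≤ Real.pi / 2 ∧
        (0 < B.alpha0 → l = 0) ∧ Tendsto B.phase (𝓝[>] 0) (𝓝 l) := fun {B} h => by
      rcases h.alpha0_nonneg.eq_or_lt with h0 | h0
      · exact ⟨_, by positivity, le_rfl, fun h1 => absurd h1 (by simp [← h0]),
          h.tendsto_phase_of_eq_zero h0.symm⟩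
      · exact ⟨0, le_rfl, by positivity, fun _ => rfl, h.tendsto_phase_of_pos h0⟩
    obtain ⟨l, h1, h2, h3, h4⟩ := aux hB
    obtain ⟨l', h1', h2', h3', h4'⟩ := aux hB'
    refine ⟨l + l', by positivity, ?_, h4.add h4'⟩
    rcases hα with h | h
    · linarith [h3 h]
    · linarith [h3' h]
  have hpos : ∀ t, 0 < t → 0 < G t := fun t ht => by
    have h1 : l ≤ G (t / 2) := by
      refine le_of_tendsto hl ?_
      filter_upwards [Ioo_mem_nhdsGT (half_pos ht)] with s hs
      exact (hmono hs.1 (half_pos ht) hs.2).le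
    exact (hl0.trans h1).trans_lt (hmono (half_pos ht) ht (half_lt_self ht))
  obtain ⟨t₀, ht₀, ht₀pi⟩ : ∃ t, 0 < t ∧ G t < Real.pi := by
    obtain ⟨t, h1, h2⟩ := ((hl.eventually_lt_const hl1).and self_mem_nhdsWithin).exists
    exact ⟨t, h2, h1⟩
  have hge : ∀ t, 0 < t → 2 * t - Real.pi < G t := fun t ht => by
    have h1 := hB.neg_pi_div_two_lt_arg ht
    have h2 := hB'.neg_pi_div_two_lt_arg ht
    simp only [hG, phase]
    linarith
  have hex : ∀ k : ℕ, ∃ t, 0 < t ∧ G t = (k + 1) * Real.pi := fun k => by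
    have hk : Real.pi ≤ (k + 1) * Real.pi := by
      nlinarith [Real.pi_pos, (Nat.cast_nonneg k : (0 : ℝ) ≤ k)]
    set t₁ := max t₀ ((k + 1) * Real.pi) with ht₁
    have h1 : (k + 1) * Real.pi ≤ G t₁ := by
      have h2 := hge t₁ (ht₀.trans_le (le_max_left _ _))
      have h3 : (k + 1) * Real.pi ≤ t₁ := le_max_right _ _
      linarith
    obtain ⟨t, ht, hGt⟩ := intermediate_value_Icc (le_max_left t₀ ((k + 1) * Real.pi))
      (hcont.mono fun x hx => ht₀.trans_le hx.1) ⟨(ht₀pi.trans_le hk).le, h1⟩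
    exact ⟨t, ht₀.trans_le ht.1, hGt⟩
  choose σ hσ using hex
  refine ⟨σ, strictMono_nat_of_lt_succ fun k => ?_, hσ, fun t ht n hn => ?_⟩
  · refine (hmono.lt_iff_lt (hσ k).1 (hσ (k + 1)).1).1 ?_
    rw [(hσ k).2, (hσ (k + 1)).2]
    push_cast
    nlinarith [Real.pi_pos]
  · have hn0 : 0 < n := by
      have := hpos t ht
      change 0 < B.phase t + B'.phase t at this
      rw [hn] at this
      exact_mod_cast pos_of_mul_pos_left this Real.pi_pos.le
    refine ⟨(n - 1).toNat, hmono.injOn ht (hσ _).1 ?_⟩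
    rw [(hσ _).2]
    have : (((n - 1).toNat : ℤ) : ℝ) = n - 1 := by
      rw [Int.toNat_of_nonneg (by omega)]
      push_cast
      rfl
    rw [Int.cast_natCast] at this
    rw [this, sub_add_cancel]
    exact hn

end BoundaryData

lemma eigenfunction_of_phase_eq {B B' : BoundaryData} (hB : B.Regular)
    (hB' : B'.reflect.Regular) {s : ℝ} (hs : 0 < s) {n : ℤ}
    (hn : B.phase s + B'.reflect.phase s = n * Real.pi) :
    IsEigenfunction (MultiPointBC B' B) (s ^ 2)
      fun x => Real.sin (s * x + B'.reflect.phase s) := by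
  set φ := B'.reflect.phase s with hφ
  have hd : ∀ x, HasDerivAt (fun x => s * x + φ) s x := fun x => by
    simpa using ((hasDerivAt_id x).const_mul s).add_const φ
  have h1 : ∀ x, HasDerivAt (fun x => Real.sin (s * x + φ)) (s * Real.cos (s * x + φ)) x :=
    fun x => by simpa [mul_comm] using (hd x).sin
  have h2 : ∀ x, HasDerivAt (fun x => s * Real.cos (s * x + φ))
      (-s ^ 2 * Real.sin (s * x + φ)) x := fun x => by
    refine ((hd x).cos.const_mul s).congr_deriv ?_
    ring
  have hD : ∀ x ∈ I, D (fun x => Real.sin (s * x + φ)) x = s * Real.cos (s * x + φ) :=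
    fun x hx => (h1 x).hasDerivWithinAt.derivWithin (uniqueDiffOn_I x hx)
  have hexp : ∀ y : ℝ, (Complex.exp (y * Complex.I)).im = Real.sin y := fun y =>
    Complex.exp_ofReal_mul_I_im y
  have hexp' : ∀ y : ℝ, (Complex.exp (y * Complex.I)).re = Real.cos y := fun y =>
    Complex.exp_ofReal_mul_I_re y
  refine ⟨⟨ContDiff.contDiffOn (by fun_prop), ?_, ?_⟩, fun x hx => ?_, ?_⟩
  · refine (B'.holdsFor_reflect 1 (fun x => Real.sin (s * x + φ))
      (D fun x => Real.sin (s * x + φ))).1 ?_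
    refine (hB'.holdsFor_iff hs (c := -Complex.exp (-φ * Complex.I)) fun x hx => ?_).2 ?_
    · have hx' : -x ∈ I := ⟨by linarith [hx.2], by linarith [hx.1]⟩
      rw [hD _ hx', neg_mul, ← Complex.exp_add]
      have : (-φ * Complex.I + s * x * Complex.I : ℂ) = ((-(s * -x + φ) : ℝ) : ℂ) * Complex.I := by
        push_cast; ring
      rw [this, Complex.neg_im, Complex.neg_re, hexp, hexp', Real.sin_neg, Real.cos_neg]
      constructor <;> ring
    · rw [neg_mul, ← Complex.exp_add, ← hφ, neg_mul, neg_add_cancel]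
      simp
  · refine (hB.holdsFor_iff hs (u := fun x => Real.sin (s * x + φ))
      (v := D fun x => Real.sin (s * x + φ)) (c := Complex.exp (φ * Complex.I)) fun x hx => ?_).2 ?_
    · rw [hD _ hx, ← Complex.exp_add]
      have : (φ * Complex.I + s * x * Complex.I : ℂ) = ((s * x + φ : ℝ) : ℂ) * Complex.I := by
        push_cast; ring
      rw [this, hexp, hexp']
      exact ⟨rfl, rfl⟩
    · rw [← Complex.exp_add, ← add_mul, ← Complex.ofReal_add, hexp, add_comm φ, hn,
        Real.sin_int_mul_pi]
  · have hxI : x ∈ I := Set.Ioo_subset_Icc_self hx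
    have : D (D fun x => Real.sin (s * x + φ)) x = -s ^ 2 * Real.sin (s * x + φ) := by
      refine HasDerivWithinAt.derivWithin ?_ (uniqueDiffOn_I x hxI)
      exact (h2 x).hasDerivWithinAt.congr hD (hD x hxI)
    rw [this]
    ring
  · by_contra! h
    have h0 : ∀ x ∈ I, s * Real.cos (s * x + φ) = 0 := fun x hx => by
      rw [← hD x hx]
      refine ((hasDerivWithinAt_const x I (0 : ℝ)).congr h (h x hx)).derivWithin
        (uniqueDiffOn_I x hx)
    have hm : (0 : ℝ) ∈ I := ⟨by norm_num, by norm_num⟩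
    have := Real.sin_sq_add_cos_sq (s * 0 + φ)
    rw [h 0 hm, (mul_eq_zero.1 (h0 0 hm)).resolve_left hs.ne'] at this
    norm_num at this

lemma IsEigenfunction.exists_eq_sin {B B' : BoundaryData} (hB : B.Regular)
    (hB' : B'.reflect.Regular) {s : ℝ} (hs : 0 < s) {u : ℝ → ℝ}
    (h : IsEigenfunction (MultiPointBC B' B) (s ^ 2) u) :
    (∃ n : ℤ, B.phase s + B'.reflect.phase s = n * Real.pi) ∧
      ∃ r ≠ 0, ∀ x ∈ I, u x = r * Real.sin (s * x + B'.reflect.phase s) ∧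
        D u x = s * (r * Real.cos (s * x + B'.reflect.phase s)) := by
  obtain ⟨⟨hu, hbc', hbc⟩, hode, x₀, hx₀, hne⟩ := h
  obtain ⟨c, hc⟩ := (isSolution_of_contDiffOn hu hode).exists_eq_im_exp hs.ne'
  set φ := B'.reflect.phase s with hφ
  have h1 := (hB.holdsFor_iff hs hc).1 hbc
  have h2 : (-(starRingEnd ℂ) c * Complex.exp (φ * Complex.I)).im = 0 := by
    refine (hB'.holdsFor_iff hs (c := -(starRingEnd ℂ) c) fun x hx => ?_).1
      ((B'.holdsFor_reflect 1 _ _).2 hbc')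
    have hx' : -x ∈ I := ⟨by linarith [hx.2], by linarith [hx.1]⟩
    obtain ⟨h3, h4⟩ := hc _ hx'
    have : -(starRingEnd ℂ) c * Complex.exp (s * x * Complex.I) =
        -(starRingEnd ℂ) (c * Complex.exp (s * (-x : ℝ) * Complex.I)) := by
      rw [map_mul, ← Complex.exp_conj]
      simp
    rw [this, h3, h4, Complex.neg_im, Complex.conj_im, neg_neg, Complex.neg_re, Complex.conj_re]
    exact ⟨rfl, (mul_neg _ _).symm⟩
  have h3 : (c * Complex.exp (-φ * Complex.I)).im = 0 := by
    have : -(starRingEnd ℂ) c * Complex.exp (φ * Complex.I) =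
        -(starRingEnd ℂ) (c * Complex.exp (-φ * Complex.I)) := by
      rw [map_mul, ← Complex.exp_conj]
      simp
    rwa [this, Complex.neg_im, Complex.conj_im, neg_neg] at h2
  -- The condition at `-1` fixes the direction of `c` up to a real factor; the one at `1` then
  -- quantizes `s`.
  obtain ⟨r, hr⟩ : ∃ r : ℝ, c = r * Complex.exp (φ * Complex.I) := by
    refine ⟨(c * Complex.exp (-φ * Complex.I)).re, ?_⟩
    have h4 : (((c * Complex.exp (-φ * Complex.I)).re : ℝ) : ℂ) =
        c * Complex.exp (-φ * Complex.I) := Complex.ext (by simp) (by rw [h3]; simp)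
    rw [h4, mul_assoc, ← Complex.exp_add, ← add_mul, neg_add_cancel, zero_mul, Complex.exp_zero,
      mul_one]
  have hr0 : r ≠ 0 := by
    rintro rfl
    apply hne
    rw [(hc x₀ hx₀).1, hr]
    simp
  refine ⟨?_, r, hr0, fun x hx => ?_⟩
  · rw [hr, mul_assoc, ← Complex.exp_add, ← add_mul, ← Complex.ofReal_add, Complex.im_ofReal_mul,
      Complex.exp_ofReal_mul_I_im] at h1
    obtain ⟨n, hn⟩ := Real.sin_eq_zero_iff.1 ((mul_eq_zero.1 h1).resolve_left hr0)
    exact ⟨n, by rw [add_comm, hn]⟩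
  · have : c * Complex.exp (s * x * Complex.I) =
        r * Complex.exp ((s * x + φ : ℝ) * Complex.I) := by
      rw [hr, mul_assoc, ← Complex.exp_add]
      push_cast
      ring_nf
    obtain ⟨h4, h5⟩ := hc x hx
    rw [h4, h5, this, Complex.im_ofReal_mul, Complex.re_ofReal_mul, Complex.exp_ofReal_mul_I_im,
      Complex.exp_ofReal_mul_I_re]
    exact ⟨rfl, rfl⟩

lemma exists_seq_spec {B B' : BoundaryData} (hB : B.Regular) (hB' : B'.reflect.Regular)
    (hα : 0 < B.alpha0 ∨ 0 < B'.alpha0) :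
    ∃ σ : ℕ → ℝ,
      (∀ k, 0 < σ k ∧ B.phase (σ k) + B'.reflect.phase (σ k) = (k + 1) * Real.pi) ∧
      IsIncreasingEnumeration (spec (MultiPointBC B' B)) fun k => σ k ^ 2 := by
  obtain ⟨σ, hmono, hσ, huniq⟩ := BoundaryData.exists_seq_phase_eq hB hB' hα
  refine ⟨σ, hσ, fun k l hkl => pow_lt_pow_left₀ (hmono hkl) (hσ k).1.le two_ne_zero,
    Set.Subset.antisymm ?_ ?_⟩
  · rintro _ ⟨k, rfl⟩
    exact ⟨_, eigenfunction_of_phase_eq hB hB' (hσ k).1 (n := k + 1)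
      (by rw [(hσ k).2]; push_cast; rfl)⟩
  · rintro lam ⟨u, hu⟩
    have hlam : 0 < lam := by
      by_contra! hle
      obtain ⟨⟨hc, hbc', hbc⟩, hode, x, hx, hne⟩ := hu
      exact hne ((isSolution_of_contDiffOn hc hode).eq_zero_of_nonpos hB hB' hα hle hbc
        ((B'.holdsFor_reflect 1 _ _).2 hbc') x hx)
    have hs := Real.sqrt_pos.2 hlam
    rw [← Real.sq_sqrt hlam.le] at hu
    obtain ⟨⟨n, hn⟩, -⟩ := hu.exists_eq_sin hB hB' hs
    obtain ⟨k, hk⟩ := huniq _ hs n hn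
    exact ⟨k, by simp only [← hk, Real.sq_sqrt hlam.le]⟩

/-! ### Nodal properties of sine functions -/

lemma neg_mem_X {Bm Bp : BoundaryData} {u : ℝ → ℝ} (h : u ∈ X (MultiPointBC Bm Bp)) :
    -u ∈ X (MultiPointBC Bm Bp) := by
  have hD : ∀ x, D (-u) x = -D u x := fun x => derivWithin.neg
  have aux : ∀ (B : BoundaryData) (e : ℝ), B.Holds e u → B.Holds e (-u) := fun B e hB => by
    simp only [BoundaryData.Holds, Pi.neg_apply, hD, mul_neg, Finset.sum_neg_distrib] at hB ⊢
    linarith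
  exact ⟨h.1.neg, aux _ _ h.2.1, aux _ _ h.2.2⟩

lemma ncard_interiorZeros_sin {u : ℝ → ℝ} {s φ r : ℝ} (hs : 0 < s) (hr : r ≠ 0)
    (hu : ∀ x ∈ I, u x = r * Real.sin (s * x + φ)) {a b : ℤ}
    (hab : ∀ j : ℤ, j ∈ Finset.Icc a b ↔ -s + φ < j * Real.pi ∧ j * Real.pi < s + φ) :
    (interiorZeros u).Finite ∧ (interiorZeros u).ncard = (b + 1 - a).toNat := by
  have heq : interiorZeros u = (fun j : ℤ => (j * Real.pi - φ) / s) '' (Finset.Icc a b : Set ℤ) := by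
    ext x
    constructor
    · rintro ⟨hx, h0⟩
      rw [hu x (Set.Ioo_subset_Icc_self hx), mul_eq_zero, or_iff_right hr,
        Real.sin_eq_zero_iff] at h0
      obtain ⟨j, hj⟩ := h0
      refine ⟨j, (hab j).2 ?_, ?_⟩
      · rw [hj]
        constructor <;> nlinarith [hx.1, hx.2]
      · simp only [hj]
        field_simp
        ring
    · rintro ⟨j, hj, rfl⟩
      obtain ⟨h1, h2⟩ := (hab j).1 hj
      have hx : (j * Real.pi - φ) / s ∈ Set.Ioo (-1 : ℝ) 1 := by
        constructor
        · rw [lt_div_iff₀ hs]; linarith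
        · rw [div_lt_iff₀ hs]; linarith
      refine ⟨hx, ?_⟩
      rw [hu _ (Set.Ioo_subset_Icc_self hx), mul_div_cancel₀ _ hs.ne', sub_add_cancel,
        Real.sin_int_mul_pi, mul_zero]
  have hinj : Function.Injective fun j : ℤ => (j * Real.pi - φ) / s := fun i j hij => by
    simp only at hij
    have h1 := (div_left_inj' hs.ne').1 hij
    have h2 := mul_right_cancel₀ Real.pi_ne_zero (sub_left_injective h1)
    exact_mod_cast h2
  rw [heq]
  refine ⟨(Finset.finite_toSet _).image _, ?_⟩
  rw [Set.ncard_image_of_injective _ hinj, Set.ncard_coe_finset, Int.card_Icc]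

lemma sin_mem_RPlus {BC : (ℝ → ℝ) → Prop} {u : ℝ → ℝ} {s φ r : ℝ} {k : ℕ} (hu : u ∈ X BC)
    (hs : 0 < s) (hr : 0 < r) (hsol : ∀ x ∈ I, u x = r * Real.sin (s * x + φ) ∧
      D u x = s * (r * Real.cos (s * x + φ)))
    (h1 : -(Real.pi / 2) < -s + φ) (h2 : -s + φ < Real.pi / 2) (h3 : k * Real.pi < s + φ)
    (h4 : s + φ < (k + 1) * Real.pi) : u ∈ RPlus BC k := by
  have hpi := Real.pi_pos
  have hmem : (1 : ℝ) ∈ I := ⟨by norm_num, le_rfl⟩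
  have hmem' : (-1 : ℝ) ∈ I := ⟨le_rfl, by norm_num⟩
  -- Zeros correspond to the multiples `jπ` between `-s + φ` and `s + φ`. The last index is `k`; the
  -- first is `0` or `1` according to the sign of `-s + φ`, hence `k + 1` or `k` zeros.
  obtain ⟨a, ha, hab⟩ : ∃ a : ℤ, (a = 0 ∨ a = 1) ∧ ∀ j : ℤ, j ∈ Finset.Icc a (k : ℤ) ↔
      -s + φ < j * Real.pi ∧ j * Real.pi < s + φ := by
    have hup : ∀ j : ℤ, j ≤ (k : ℤ) ↔ j * Real.pi < s + φ := fun j => by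
      constructor
      · intro h
        have : (j : ℝ) ≤ k := by exact_mod_cast h
        exact (mul_le_mul_of_nonneg_right this hpi.le).trans_lt h3
      · intro h
        have : (j : ℝ) < k + 1 := lt_of_mul_lt_mul_right (h.trans h4) hpi.le
        exact Int.lt_add_one_iff.1 (by exact_mod_cast this)
    rcases lt_or_ge (-s + φ) 0 with h0 | h0
    · refine ⟨0, Or.inl rfl, fun j => ?_⟩
      rw [Finset.mem_Icc, hup]
      refine and_congr_left fun _ => ⟨fun h => ?_, fun h => ?_⟩
      · have : (0 : ℝ) ≤ j := by exact_mod_cast h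
        exact h0.trans_le (by positivity)
      · by_contra! h5
        have : (j : ℝ) ≤ -1 := by exact_mod_cast Int.le_sub_one_of_lt h5
        nlinarith
    · refine ⟨1, Or.inr rfl, fun j => ?_⟩
      rw [Finset.mem_Icc, hup]
      refine and_congr_left fun _ => ⟨fun h => ?_, fun h => ?_⟩
      · have : (1 : ℝ) ≤ j := by exact_mod_cast h
        nlinarith
      · have := pos_of_mul_pos_left (h0.trans_lt h) hpi.le
        exact Int.add_one_le_iff.2 (by exact_mod_cast this)
  obtain ⟨hfin, hcard⟩ := ncard_interiorZeros_sin hs hr.ne' (fun x hx => (hsol x hx).1) hab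
  have hu1 : u 1 = (-1) ^ k * (r * Real.sin (s + φ - k * Real.pi)) := by
    rw [(hsol 1 hmem).1, Real.sin_sub_nat_mul_pi, mul_one]
    have : ((-1 : ℝ) ^ k) * (-1) ^ k = 1 := by rw [← mul_pow]; simp
    linear_combination (-r * Real.sin (s + φ)) * this
  have hpos : 0 < r * Real.sin (s + φ - k * Real.pi) :=
    mul_pos hr (Real.sin_pos_of_pos_of_lt_pi (by linarith) (by linarith))
  refine ⟨hu, ?_, ?_, ?_, ?_, hfin, ?_⟩
  · rw [(hsol _ hmem').2]
    have : 0 < Real.cos (s * -1 + φ) := Real.cos_pos_of_mem_Ioo ⟨by linarith, by linarith⟩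
    positivity
  · rw [Int.even_coe_nat]
    refine ⟨fun h => ?_, fun h => ?_⟩
    · by_contra hk
      rw [hu1, (Nat.not_even_iff_odd.1 hk).neg_one_pow] at h
      linarith
    · rw [hu1, h.neg_one_pow]
      linarith
  · rw [Int.odd_coe_nat]
    refine ⟨fun h => ?_, fun h => ?_⟩
    · by_contra hk
      rw [hu1, (Nat.not_odd_iff_even.1 hk).neg_one_pow] at h
      linarith
    · rw [hu1, h.neg_one_pow]
      linarith
  · rintro x ⟨hx, h0⟩ hD
    obtain ⟨h5, h6⟩ := hsol x (Set.Ioo_subset_Icc_self hx)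
    rw [h5, mul_eq_zero, or_iff_right hr.ne'] at h0
    rw [h6, mul_eq_zero, or_iff_right hs.ne', mul_eq_zero, or_iff_right hr.ne'] at hD
    have := Real.sin_sq_add_cos_sq (s * x + φ)
    rw [h0, hD] at this
    norm_num at this
  · rw [hcard]
    rcases ha with rfl | rfl
    · right; omega
    · left; omega

lemma sin_mem_R {Bm Bp : BoundaryData} {u : ℝ → ℝ} {s φ r : ℝ} {k : ℕ}
    (hu : u ∈ X (MultiPointBC Bm Bp)) (hs : 0 < s) (hr : r ≠ 0)
    (hsol : ∀ x ∈ I, u x = r * Real.sin (s * x + φ) ∧ D u x = s * (r * Real.cos (s * x + φ)))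
    (h1 : -(Real.pi / 2) < -s + φ) (h2 : -s + φ < Real.pi / 2) (h3 : k * Real.pi < s + φ)
    (h4 : s + φ < (k + 1) * Real.pi) : u ∈ R (MultiPointBC Bm Bp) k := by
  rcases hr.lt_or_gt with hr | hr
  · refine Or.inr (sin_mem_RPlus (r := -r) (neg_mem_X hu) hs (by linarith) (fun x hx => ?_)
      h1 h2 h3 h4)
    have hD : D (-u) x = -D u x := derivWithin.neg
    rw [hD, Pi.neg_apply, (hsol x hx).1, (hsol x hx).2]
    constructor <;> ring
  · exact Or.inl (sin_mem_RPlus hu hs hr hsol h1 h2 h3 h4)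

/-! ### The mixed problem and the thresholds `J` -/

/-- The eigenvalues `λ_k^M` are the squares of `(k + 1/2) π / 2`. -/
lemma isIncreasingEnumeration_mixed :
    IsIncreasingEnumeration (spec MixedBC) fun k => ((2 * k + 1) * Real.pi / 4) ^ 2 := by
  -- The mixed conditions are multi-point data with no nonlocal terms, which `Regular` allows.
  set Bm : BoundaryData := ⟨0, 0, -1, Fin.elim0, Fin.elim0, Fin.elim0⟩ with hBm
  set Bp : BoundaryData := ⟨0, 1, 0, Fin.elim0, Fin.elim0, Fin.elim0⟩ with hBp
  have hBC : MixedBC = MultiPointBC Bm Bp := by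
    funext u
    simp [MixedBC, MultiPointBC, BoundaryData.Holds, hBm, hBp]
  have hp : Bp.Regular := ⟨by simp [hBp], by simp [hBp], by simp [hBp], fun i => i.elim0,
    ⟨by simp [hBp], by simp [hBp], by simp [hBp]⟩⟩
  have hα : ∑ i, |Bm.reflect.alpha i| = 0 := Finset.sum_eq_zero fun i _ => i.elim0
  have hβ : ∑ i, |Bm.reflect.beta i| = 0 := Finset.sum_eq_zero fun i _ => i.elim0
  have hm : Bm.reflect.Regular := ⟨by simp [hBm, BoundaryData.reflect],
    by simp [hBm, BoundaryData.reflect], by simp [hBm, BoundaryData.reflect], fun i => i.elim0,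
    ⟨fun _ => hα, fun _ => hβ, by rw [hα, hβ]; simp⟩⟩
  obtain ⟨σ, hσ, henum⟩ := exists_seq_spec hp hm (Or.inl (by simp [hBp]))
  have hval : ∀ k : ℕ, σ k = (2 * k + 1) * Real.pi / 4 := fun k => by
    obtain ⟨h0, h1⟩ := hσ k
    have e1 : Bp.symbol (σ k) = 1 := by simp [BoundaryData.symbol, hBp]
    have e2 : Bm.reflect.symbol (σ k) = (σ k : ℂ) * Complex.I := by
      rw [BoundaryData.symbol, Finset.sum_eq_zero fun i _ => i.elim0]
      simp [hBm, BoundaryData.reflect]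
    rw [BoundaryData.phase, BoundaryData.phase, e1, e2, Complex.arg_real_mul _ h0, Complex.arg_I,
      Complex.arg_one] at h1
    linarith
  rw [hBC]
  simpa only [hval] using henum

namespace BoundaryData

lemma alpha0_lt_of_J_lt {B : BoundaryData} (hα : 0 ≤ B.alpha0) {t : ℝ} (ht : 0 < t)
    (h : B.J < ((t ^ 2 : ℝ) : EReal)) : B.alpha0 < |B.beta0| * t := by
  unfold J at h
  split_ifs at h with h0
  · exact absurd h (by simp)
  · have h1 := EReal.coe_lt_coe_iff.1 h
    have h2 := abs_lt_of_sq_lt_sq h1 ht.le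
    rw [abs_div, abs_of_nonneg hα, div_lt_iff₀ (abs_pos.2 h0), mul_comm] at h2
    exact h2

lemma lt_alpha0_of_lt_J {B : BoundaryData} (hα : 0 ≤ B.alpha0) (hpos : 0 < B.alpha0 + |B.beta0|)
    {t : ℝ} (ht : 0 ≤ t) (h : ((t ^ 2 : ℝ) : EReal) < B.J) : |B.beta0| * t < B.alpha0 := by
  unfold J at h
  split_ifs at h with h0
  · simpa [h0] using hpos
  · have h1 := EReal.coe_lt_coe_iff.1 h
    have h2 := sq_lt_sq.1 h1
    rw [abs_div, abs_of_nonneg hα, abs_of_nonneg ht, lt_div_iff₀ (abs_pos.2 h0), mul_comm] at h2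
    exact h2

end BoundaryData

lemma exists_isKTM {J : EReal} (hJ0 : 0 ≤ J) (hJ : J < ⊤) :
    ∃ kT, IsKTM (fun k => ((2 * k + 1) * Real.pi / 4) ^ 2) J kT := by
  lift J to ℝ using ⟨hJ.ne, fun h => by simp [h] at hJ0⟩
  have hpi := Real.pi_gt_three
  obtain ⟨N, hN⟩ := exists_nat_gt J
  refine Int.exists_greatest_of_bdd (P := fun k => -1 ≤ k ∧ _) ⟨N, fun k hk => ?_⟩
    ⟨-1, le_rfl, by simpa [ext] using hJ0⟩ |>.imp fun k hk => ⟨hk.1, fun j hj => hk.2 j hj⟩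
  by_contra! hlt
  have hk0 : 0 ≤ k := by omega
  have h1 := hk.2
  rw [ext, if_pos hk0, EReal.coe_le_coe_iff] at h1
  have h2 : (N : ℝ) ≤ k.toNat := by exact_mod_cast (by omega : N ≤ k.toNat)
  have h3 : (k.toNat : ℝ) + 1 / 2 ≤ (2 * k.toNat + 1) * Real.pi / 4 := by nlinarith
  have h4 : (1 : ℝ) ≤ k.toNat := by exact_mod_cast (by omega : 1 ≤ k.toNat)
  nlinarith

end MultiPoint

/-! ### The main theorem -/

theorem mainTheorem3 (Bm Bp : MultiPoint.BoundaryData)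
    (hm : Bm.Admissible (-1)) (hp : Bp.Admissible 1)
    (hsm : Bm.Strengthened) (hsp : Bp.Strengthened)
    (hJ : Bp.J < Bm.J) :
    ∃ (lam lamM : ℕ → ℝ) (kT : ℤ),
      MultiPoint.IsIncreasingEnumeration
        (MultiPoint.spec (MultiPoint.MultiPointBC Bm Bp)) lam ∧
      MultiPoint.IsIncreasingEnumeration (MultiPoint.spec MultiPoint.MixedBC) lamM ∧
      MultiPoint.IsKTM lamM (min Bp.J Bm.J) kT ∧
      ∀ k : ℕ, kT + 1 ≤ (k : ℤ) →
        (k : ℕ∞) + 1 ≤ MultiPoint.kSM lamM (max Bp.J Bm.J) →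
        (∀ ψ : ℝ → ℝ, MultiPoint.IsEigenfunction (MultiPoint.MultiPointBC Bm Bp) (lam k) ψ →
          ψ ∈ MultiPoint.R (MultiPoint.MultiPointBC Bm Bp) k) ∧
        MultiPoint.ext lamM ((k : ℤ) - 1) < lam k ∧ lam k < lamM (k + 1) := by
  have hB := hp.regular hsp
  have hB' := hm.regular_reflect hsm
  have hpi := Real.pi_pos
  have hJ0 : 0 ≤ Bp.J := by
    unfold MultiPoint.BoundaryData.J
    split_ifs
    · exact le_top
    · exact EReal.coe_nonneg.2 (sq_nonneg _)
  have habs : |Bm.beta0| = Bm.reflect.beta0 := by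
    have : Bm.beta0 ≤ 0 := by simpa using hm.sign_beta0
    exact abs_of_nonpos this
  have habs' : |Bp.beta0| = Bp.beta0 := abs_of_nonneg hB.beta0_nonneg
  have hα : 0 < Bm.alpha0 := by
    have h0 : (((0 : ℝ) ^ 2 : ℝ) : EReal) < Bm.J := by
      simpa using hJ0.trans_lt hJ
    simpa using Bm.lt_alpha0_of_lt_J hm.alpha0_nonneg hm.alpha0_beta0_pos le_rfl h0
  obtain ⟨σ, hσ, henum⟩ := MultiPoint.exists_seq_spec hB hB' (Or.inr hα)
  rw [min_eq_left hJ.le, max_eq_right hJ.le]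
  obtain ⟨kT, hkT⟩ := MultiPoint.exists_isKTM hJ0 (hJ.trans_le le_top)
  refine ⟨_, _, kT, henum, MultiPoint.isIncreasingEnumeration_mixed, hkT, fun k hk hkS => ?_⟩
  set t : ℝ := (2 * k + 1) * Real.pi / 4 with ht
  have ht0 : 0 < t := by positivity
  have hJt : Bp.J < ((t ^ 2 : ℝ) : EReal) := by
    by_contra! hle
    have : (k : ℤ) ≤ kT := hkT.2 ⟨by omega, by simpa [MultiPoint.ext, ht] using hle⟩
    omega
  have htJ : ((t ^ 2 : ℝ) : EReal) < Bm.J := by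
    by_contra! hle
    have h1 := hkS.trans (sInf_le ⟨k, hle, rfl⟩)
    have h2 : k + 1 ≤ k := by exact_mod_cast h1
    omega
  have hp1 := Bp.alpha0_lt_of_J_lt hp.alpha0_nonneg ht0 hJt
  have hm1 := Bm.lt_alpha0_of_lt_J hm.alpha0_nonneg hm.alpha0_beta0_pos ht0.le htJ
  rw [habs'] at hp1
  rw [habs] at hm1
  obtain ⟨hs, hG⟩ := hσ k
  set s := σ k with hsdef
  have e1 : Bm.reflect.phase s = s + (Bm.reflect.symbol s).arg := rfl
  have e2 : Bp.phase s = s + (Bp.symbol s).arg := rfl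
  have b1 := hB.arg_lt_pi hs
  have b2 := hB.neg_pi_div_two_lt_arg hs
  have b3 := hB'.arg_lt_pi hs
  have b4 := hB'.neg_pi_div_two_lt_arg hs
  have hsum : (Bp.symbol s).arg + (Bm.reflect.symbol s).arg = (k + 1) * Real.pi - 2 * s := by
    linarith
  -- As `(k + 1)π - 2t = π/2`, the two arguments add up to at least `π/2` if `s ≤ t` and to at most
  -- `π/2` if `s ≥ t`. On either side of `t` one bound comes from the threshold and the other from
  -- this sum.
  have harg : 0 < (Bp.symbol s).arg ∧ (Bm.reflect.symbol s).arg < Real.pi / 2 := by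
    rcases le_total s t with hst | hst
    · have h1 := hB'.arg_lt_pi_div_two hs
        ((mul_le_mul_of_nonneg_left hst hB'.beta0_nonneg).trans hm1.le)
      exact ⟨by linarith, h1⟩
    · have h1 := hB.arg_pos hs
        (hp1.le.trans (mul_le_mul_of_nonneg_left hst hB.beta0_nonneg))
      exact ⟨h1, by linarith⟩
  -- The phase of `ψ` is `arg V⁻` at `-1` and `(k + 1)π - arg V⁺` at `1`. The sum of the arguments
  -- lies in `(-π/2, 3π/2)`, so `(2k-1)π/4 < s < (2k+3)π/4`.
  refine ⟨fun ψ hψ => ?_, ?_, ?_⟩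
  · obtain ⟨-, r, hr, hsol⟩ := hψ.exists_eq_sin hB hB' hs
    exact MultiPoint.sin_mem_R hψ.1 hs hr hsol (by linarith) (by linarith [harg.2])
      (by linarith) (by linarith [harg.1])
  · rw [MultiPoint.ext]
    split_ifs with hk1
    · obtain ⟨j, rfl⟩ : ∃ j, k = j + 1 := ⟨k - 1, by omega⟩
      have : ((j + 1 : ℕ) - 1 : ℤ).toNat = j := by omega
      rw [this]
      refine pow_lt_pow_left₀ ?_ (by positivity) two_ne_zero
      push_cast at hsum
      linarith [harg.2]
    · exact pow_pos hs 2
  · refine pow_lt_pow_left₀ ?_ hs.le two_ne_zero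
    push_cast
    linarith [harg.1]
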